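/- Let $B_n$ be the braid group on $n$ strands, with Artin generators $\sigma_1,\dots,\sigma_{n-1}$. For $n\ge t>s\ge 1$ let $$a_{ts}=(\sigma_{t-1}\sigma_{t-2}\cdots\sigma_{s+1})\,\sigma_s\,(\sigma_{t-1}\sigma_{t-2}\cdots\sigma_{s+1})^{-1}\in B_n$$ be the band generators, and let $\delta=a_{n(n-1)}a_{(n-1)(n-2)}\cdots a_{21}$. A positive word is a finite (possibly empty) word in the letters $a_{ts}$; a positive braid is an element of the submonoid $B_n^+\subset B_n$ generated by the $a_{ts}$. For $V,W\in B_n$ write $V\le W$ if $W=P_1VP_2$ for some $P_1,P_2\in B_n^+$. A braid $W\in B_n$ is called a canonical factor if $e\le W\le\delta$, where $e$ is the identity. An ordered pair $(a,b)$ of letters is called obstructing if it is of one of the following six forms, where the indices that occur in the form lie in $\{1,\dots,n\}$ and satisfy $t>s>r>q$: 1. $(a,b)=(a_{tr},a_{sq})$; 2. $(a,b)=(a_{sq},a_{tr})$; 3. $(a,b)=(a_{sr},a_{ts})$; 4. $(a,b)=(a_{ts},a_{tr})$; 5. $(a,b)=(a_{tr},a_{sr})$; 6. $(a,b)=(a_{ts},a_{ts})$.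 A positive word $A$ contains an obstructing pair if it can be written as a concatenation $A=BaCbD$ with positive (possibly empty) words $B,C,D$ and letters $a,b$ such that $(a,b)$ is obstructing. Then a positive word $A$ represents a canonical factor if and only if $A$ contains no obstructing pair. -/

import Mathlib

namespace BandBraid

/-- The relators of Artin's presentation of the braid group on `n` strands. The generator with
index `i : Fin (n - 1)` (indices start at `0`) crosses the strands `i` and `i + 1`. -/
inductive ArtinRel (n : ℕ) : FreeGroup (Fin (n - 1)) → Prop
  | comm (i j : Fin (n - 1)) (h : (i : ℕ) + 1 < j) :
      ArtinRel n ((FreeGroup.of i * FreeGroup.of j) * (FreeGroup.of j * FreeGroup.of i)⁻¹)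
  | braid (i j : Fin (n - 1)) (h : (i : ℕ) + 1 = j) :
      ArtinRel n ((FreeGroup.of i * FreeGroup.of j * FreeGroup.of i) *
        (FreeGroup.of j * FreeGroup.of i * FreeGroup.of j)⁻¹)

/-- The braid group `B_n`, by Artin's presentation. -/
abbrev BraidGroup (n : ℕ) : Type := PresentedGroup {r | ArtinRel n r}

/-- The Artin generator `σ_i`. -/
def sigma {n : ℕ} (i : Fin (n - 1)) : BraidGroup n := PresentedGroup.of i

/-- A letter `a_{ts}`, with `t > s`; the strands are numbered by `Fin n`. -/
@[ext]
structure Letter (n : ℕ) where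
  t : Fin n
  s : Fin n
  s_lt_t : s < t

/-- The index `s` of a letter `a_{ts}`, as the index of an Artin generator. -/
def Letter.low {n : ℕ} (a : Letter n) : Fin (n - 1) :=
  ⟨a.s, by have h := a.s_lt_t; have := a.t.isLt; simp only [Fin.lt_def] at h; omega⟩

/-- The product `σ_{t-1} σ_{t-2} ⋯ σ_{s+1}` (indices decreasing from left to right). -/
def Letter.conjugator {n : ℕ} (a : Letter n) : BraidGroup n :=
  ((((List.finRange (n - 1)).filter
    (fun i : Fin (n - 1) => (a.s : ℕ) < i ∧ (i : ℕ) < a.t)).reverse).map sigma).prod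

/-- The band generator
`a_{ts} = (σ_{t-1} ⋯ σ_{s+1}) σ_s (σ_{t-1} ⋯ σ_{s+1})⁻¹` of the braid group. -/
def Letter.toBraid {n : ℕ} (a : Letter n) : BraidGroup n :=
  a.conjugator * sigma a.low * a.conjugator⁻¹

/-- The letter `a_{(i+1)i}`. -/
def adjacentLetter {n : ℕ} (i : Fin (n - 1)) : Letter n where
  t := ⟨i + 1, by omega⟩
  s := ⟨i, by omega⟩
  s_lt_t := by simp [Fin.lt_def]

/-- A positive word: a finite (possibly empty) word in the letters `a_{ts}`. -/
abbrev PositiveWord (n : ℕ) : Type := List (Letter n)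

/-- The braid represented by a positive word. -/
def PositiveWord.toBraid {n : ℕ} (A : PositiveWord n) : BraidGroup n :=
  (A.map Letter.toBraid).prod

/-- The fundamental word, whose letters are `a_{(i+1)i}` with `i` decreasing from left to right. -/
def deltaWord (n : ℕ) : PositiveWord n :=
  ((List.finRange (n - 1)).reverse).map adjacentLetter

/-- The fundamental braid `δ`. -/
def delta (n : ℕ) : BraidGroup n := (deltaWord n).toBraid

/-- The positive braids: the submonoid of `B_n` generated by the band generators. -/
def positiveBraids (n : ℕ) : Submonoid (BraidGroup n) :=
  Submonoid.closure (Set.range Letter.toBraid)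

/-- `V ≤ W`: there are positive braids `P₁`, `P₂` with `W = P₁ V P₂`. -/
def BraidLE {n : ℕ} (V W : BraidGroup n) : Prop :=
  ∃ P₁ ∈ positiveBraids n, ∃ P₂ ∈ positiveBraids n, W = P₁ * V * P₂

/-- A canonical factor: a braid `W` with `e ≤ W ≤ δ`. -/
def IsCanonicalFactor {n : ℕ} (W : BraidGroup n) : Prop :=
  BraidLE 1 W ∧ BraidLE W (delta n)

/-- The six kinds of obstructing pairs `(a, b)` of letters. -/
inductive ObstructingPair {n : ℕ} : Letter n → Letter n → Prop
  | tr_sq (t s r q : Fin n) (hts : s < t) (hsr : r < s) (hrq : q < r) :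
      ObstructingPair ⟨t, r, hsr.trans hts⟩ ⟨s, q, hrq.trans hsr⟩
  | sq_tr (t s r q : Fin n) (hts : s < t) (hsr : r < s) (hrq : q < r) :
      ObstructingPair ⟨s, q, hrq.trans hsr⟩ ⟨t, r, hsr.trans hts⟩
  | sr_ts (t s r : Fin n) (hts : s < t) (hsr : r < s) :
      ObstructingPair ⟨s, r, hsr⟩ ⟨t, s, hts⟩
  | ts_tr (t s r : Fin n) (hts : s < t) (hsr : r < s) :
      ObstructingPair ⟨t, s, hts⟩ ⟨t, r, hsr.trans hts⟩
  | tr_sr (t s r : Fin n) (hts : s < t) (hsr : r < s) :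
      ObstructingPair ⟨t, r, hsr.trans hts⟩ ⟨s, r, hsr⟩
  | ts_ts (t s : Fin n) (hts : s < t) :
      ObstructingPair ⟨t, s, hts⟩ ⟨t, s, hts⟩

/-- `A` contains an obstructing pair: it is a concatenation `B a C b D` of words with
`(a, b)` an obstructing pair of letters. -/
def PositiveWord.ContainsObstructingPair {n : ℕ} (A : PositiveWord n) : Prop :=
  ∃ (B C D : PositiveWord n) (a b : Letter n),
    A = B ++ [a] ++ C ++ [b] ++ D ∧ ObstructingPair a b

end BandBraid

/-! By `obstructingPair_iff`, `(a, b)` obstructs exactly when the interval `(a.s, a.t]` contains one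
index of `b` but not the other. Necessity: a canonical factor extends to a positive word `B a C` for
`δ`, which by exponent sum has `n - 1` letters. On strands `δ` is an `n`-cycle `c`, and `(s t) c`,
with `(s t)` the transposition of `a`, has the orbits `(s, t]` and its complement. It is also the
product of `C` and the conjugate of `B` by `c`. The letters of these two factors are too few to
merge the two orbits, so a nonzero function vanishing at `0` is invariant under all of them; it must
be supported on `(s, t]`, so no letter of `C` joins the two orbits
(`not_obstructingPair_of_toBraid_eq_delta`). Sufficiency: `δ` is the chain product over all indices.
`ArtinSeq.chainProd_split` factors a chain product as `a_{ts}` times the chains inside and outside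
`(s, t]`. The letters after `a` fall into these two commuting blocks, and induction on word length
applies to each (`exists_mul_eq_chainProd`). -/

namespace BandBraid

/-! ### Relations among band generators and factorisations of chain products. -/

section Band

variable {G : Type*} [Group G]

/-- The band generator `a_{ts}` built from a sequence `σ` of elements of a group. -/
def band (σ : ℕ → G) : ℕ → ℕ → G
  | 0, _ => 1
  | t + 1, s => if t = s then σ s else σ t * band σ t s * (σ t)⁻¹

/-- The product `a_{i₁ i₂} a_{i₂ i₃} ⋯` along a list of indices. -/
def chainProd (a : ℕ → ℕ → G) : List ℕ → G
  | [] => 1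
  | [_] => 1
  | x :: y :: l => a x y * chainProd a (y :: l)

lemma band_succ_self (σ : ℕ → G) (s : ℕ) : band σ (s + 1) s = σ s := by simp [band]

lemma band_succ (σ : ℕ → G) {t s : ℕ} (h : s < t) :
    band σ (t + 1) s = σ t * band σ t s * (σ t)⁻¹ := by
  simp [band, h.ne']

lemma commute_band {σ : ℕ → G} {g : G} {t s : ℕ} (hst : s < t)
    (h : ∀ i, s ≤ i → i < t → Commute g (σ i)) : Commute g (band σ t s) := by
  induction t, hst using Nat.le_induction with
  | base => rw [band_succ_self]; exact h s le_rfl (by omega)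
  | succ t ht ih =>
    rw [band_succ σ ht]
    have h1 := h t (by omega) (by omega)
    exact (h1.mul_right (ih fun i hi hit => h i hi (by omega))).mul_right h1.inv_right

lemma map_band {H : Type*} [Group H] (φ : G →* H) (σ : ℕ → G) (t s : ℕ) :
    φ (band σ t s) = band (φ ∘ σ) t s := by
  induction t with
  | zero => simp [band]
  | succ t ih => by_cases h : t = s <;> simp [band, h, ih]

/-- The first `m` terms of the sequence `σ` satisfy the braid relations. -/
structure ArtinSeq (m : ℕ) (σ : ℕ → G) : Prop where
  comm : ∀ i j, i + 1 < j → Commute (σ i) (σ j)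
  braid : ∀ i, i + 1 < m → σ i * σ (i + 1) * σ i = σ (i + 1) * σ i * σ (i + 1)

variable {m : ℕ} {σ : ℕ → G}

lemma ArtinSeq.commute_above (h : ArtinSeq m σ) {t s i : ℕ} (hst : s < t) (hi : t < i) :
    Commute (σ i) (band σ t s) :=
  commute_band hst fun j _ hj => (h.comm j i (by omega)).symm

lemma ArtinSeq.commute_inside (h : ArtinSeq m σ) {t s i : ℕ} (hsi : s < i) (hit : i + 1 < t)
    (htm : t ≤ m) : Commute (σ i) (band σ t s) := by
  induction t, hit using Nat.le_induction with
  | base =>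
    rw [band_succ σ (by omega), band_succ σ hsi]
    have hb := h.braid i (by omega)
    have hc : Commute (σ (i + 1)) (band σ i s) := h.commute_above hsi (by omega)
    have hc' := hc.eq
    generalize band σ i s = x at *
    generalize σ i = u at *
    generalize σ (i + 1) = v at *
    have e : v * (u * x * u⁻¹) * v⁻¹ = (v * u) * x * (v * u)⁻¹ := by group
    rw [e]
    -- Conjugation by `v * u` carries `v` to `u`, so `v` commuting with `x` becomes the claim for
    -- `u`.
    have e1 : u * (v * u) = (v * u) * v := by rw [← mul_assoc, hb]
    change u * (v * u * x * (v * u)⁻¹) = v * u * x * (v * u)⁻¹ * u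
    generalize v * u = w at *
    calc u * (w * x * w⁻¹) = (u * w) * x * w⁻¹ := by group
      _ = w * (v * x) * w⁻¹ := by rw [e1]; group
      _ = w * x * w⁻¹ * (w * v) * w⁻¹ := by rw [hc']; group
      _ = w * x * w⁻¹ * u := by rw [← e1]; group
  | succ t ht ih =>
    rw [band_succ σ (by omega)]
    have h1 := h.comm i t (by omega)
    exact (h1.mul_right (ih (by omega))).mul_right h1.inv_right

/-- Band generators with nested or separated index pairs commute. -/
lemma ArtinSeq.commute_band_inside (h : ArtinSeq m σ) {t s r q : ℕ} (hqr : q < r) (hsq : s < q)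
    (hrt : r < t) (htm : t ≤ m) : Commute (band σ r q) (band σ t s) :=
  (commute_band hqr fun i hi hir =>
    (h.commute_inside (by omega) (by omega) htm).symm).symm

lemma ArtinSeq.commute_band_above (h : ArtinSeq m σ) {t s r q : ℕ} (hst : s < t) (htq : t < q)
    (hqr : q < r) : Commute (band σ r q) (band σ t s) :=
  (commute_band hqr fun i hi hir =>
    (h.commute_above hst (by omega)).symm).symm

/-- Only far commutation enters, so no bound by `m` is needed; the companion
`ArtinSeq.band_mul_band'` does need the braid relation. -/
lemma ArtinSeq.band_mul_band (h : ArtinSeq m σ) {t s r : ℕ} (hrs : r < s) (hst : s < t) :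
    band σ t s * band σ s r = band σ t r * band σ t s := by
  induction t, hst using Nat.le_induction with
  | base => rw [band_succ_self, band_succ σ hrs]; group
  | succ t ht ih =>
    have hc := (h.commute_above hrs (i := t) (by omega)).eq
    rw [band_succ σ (show s < t by omega), band_succ σ (show r < t by omega)]
    calc σ t * band σ t s * (σ t)⁻¹ * band σ s r
        = σ t * band σ t s * (σ t)⁻¹ * (band σ s r * σ t) * (σ t)⁻¹ := by group
      _ = σ t * (band σ t s * band σ s r) * (σ t)⁻¹ := by rw [← hc]; group
      _ = _ := by rw [ih]; group

lemma ArtinSeq.braid_band (h : ArtinSeq m σ) {s r : ℕ} (hrs : r < s) (hsm : s < m) :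
    σ s * band σ s r * σ s = band σ s r * σ s * band σ s r := by
  induction s, hrs using Nat.le_induction with
  | base => rw [band_succ_self]; exact (h.braid r hsm).symm
  | succ s hs ih =>
    have ih := ih (by omega)
    have hc := (h.commute_above hs (i := s + 1) (by omega)).eq
    have hb := h.braid s hsm
    rw [band_succ σ hs]
    generalize band σ s r = x at *
    generalize σ s = u at *
    generalize σ (s + 1) = v at *
    have e : u * x * u⁻¹ = x⁻¹ * u * x := by
      rw [mul_inv_eq_iff_eq_mul]
      calc u * x = x⁻¹ * (x * u * x) := by group
        _ = _ := by rw [← ih]; group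
    have hv : x * v * x⁻¹ = v := by rw [← hc]; group
    -- Conjugating by `x`, which fixes `v`, reduces the claim to the braid relation of `u` and `v`.
    rw [e]
    calc v * (x⁻¹ * u * x) * v = x⁻¹ * ((x * v * x⁻¹) * u * (x * v * x⁻¹)) * x := by group
      _ = x⁻¹ * (u * (x * v * x⁻¹) * u) * x := by rw [hv, hb]
      _ = _ := by group

lemma ArtinSeq.band_mul_band' (h : ArtinSeq m σ) {t s r : ℕ} (hrs : r < s) (hst : s < t)
    (htm : t ≤ m) : band σ t s * band σ s r = band σ s r * band σ t r := by
  induction t, hst using Nat.le_induction with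
  | base =>
    rw [band_succ_self, band_succ σ hrs]
    calc σ s * band σ s r = (σ s * band σ s r * σ s) * (σ s)⁻¹ := by group
      _ = _ := by rw [h.braid_band hrs (by omega)]; group
  | succ t ht ih =>
    have ih := ih (by omega)
    have hc := (h.commute_above hrs (i := t) (by omega)).eq
    rw [band_succ σ (show s < t by omega), band_succ σ (show r < t by omega)]
    calc σ t * band σ t s * (σ t)⁻¹ * band σ s r
        = σ t * band σ t s * (σ t)⁻¹ * (band σ s r * σ t) * (σ t)⁻¹ := by group
      _ = σ t * (band σ t s * band σ s r) * (σ t)⁻¹ := by rw [← hc]; group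
      _ = (σ t * band σ s r) * band σ t r * (σ t)⁻¹ := by rw [ih]; group
      _ = _ := by rw [hc]; group

/-- Band generators commute if an interval `(s, t]` contains both indices of the first and
neither index of the second. -/
lemma ArtinSeq.commute_of_separated (h : ArtinSeq m σ) {s t u v x y : ℕ} (hvu : v < u)
    (hyx : y < x) (hxm : x ≤ m) (hu : s < u ∧ u ≤ t) (hv : s < v ∧ v ≤ t)
    (hx : ¬ (s < x ∧ x ≤ t)) (hy : ¬ (s < y ∧ y ≤ t)) :
    Commute (band σ u v) (band σ x y) := by
  rcases lt_or_ge x v with h1 | h1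
  · exact h.commute_band_above hyx h1 hvu
  · rcases lt_or_ge u y with h2 | h2
    · exact (h.commute_band_above hvu h2 hyx).symm
    · exact h.commute_band_inside hvu (by omega) (by omega) hxm

lemma commute_chainProd {a : ℕ → ℕ → G} {g : G} {L : List ℕ} (hL : L.Pairwise (· > ·))
    (h : ∀ x ∈ L, ∀ y ∈ L, y < x → Commute g (a x y)) : Commute g (chainProd a L) := by
  induction L with
  | nil => exact Commute.one_right g
  | cons x l ih =>
    cases l with
    | nil => exact Commute.one_right g
    | cons y l =>
      have hx := List.pairwise_cons.1 hL
      exact (h x (by simp) y (by simp) (hx.1 y (by simp))).mul_right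
        (ih hx.2 fun u hu v hv => h u (List.mem_cons_of_mem _ hu) v (List.mem_cons_of_mem _ hv))

lemma chainProd_append_cons (a : ℕ → ℕ → G) (L R : List ℕ) (s : ℕ) :
    chainProd a (L ++ s :: R) = chainProd a (L ++ [s]) * chainProd a (s :: R) := by
  induction L with
  | nil => simp [chainProd]
  | cons x l ih =>
    cases l with
    | nil => simp [chainProd]
    | cons y l =>
      simp only [List.cons_append, chainProd, mul_assoc] at ih ⊢
      rw [ih]

/-- The last factor travels to the front by repeated use of `a_{tx} a_{xs} = a_{ts} a_{tx}`. -/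
lemma ArtinSeq.chainProd_concat (h : ArtinSeq m σ) {t s : ℕ} {M : List ℕ}
    (hL : (t :: M ++ [s]).Pairwise (· > ·)) :
    chainProd (band σ) (t :: M ++ [s]) = band σ t s * chainProd (band σ) (t :: M) := by
  induction M generalizing t with
  | nil => simp [chainProd]
  | cons x M ih =>
    simp only [List.cons_append, chainProd] at ih ⊢
    have hL' := List.pairwise_cons.1 hL
    have hxs := List.pairwise_cons.1 hL'.2
    rw [ih hL'.2, ← mul_assoc, h.band_mul_band (hxs.1 s (by simp)) (hL'.1 x (by simp)), mul_assoc]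

/-- Splitting off a band generator from the product along a decreasing list. -/
lemma ArtinSeq.chainProd_split (h : ArtinSeq m σ) {t s : ℕ} {K M R : List ℕ}
    (hL : (K ++ (t :: M ++ s :: R)).Pairwise (· > ·))
    (hm : ∀ x ∈ K ++ (t :: M ++ s :: R), x ≤ m) :
    chainProd (band σ) (K ++ (t :: M ++ s :: R)) =
      band σ t s * chainProd (band σ) (t :: M) * chainProd (band σ) (K ++ s :: R) := by
  induction K with
  | nil =>
    have hL' : (t :: M ++ [s]).Pairwise (· > ·) := by
      refine hL.sublist ?_
      simp
    rw [List.nil_append, chainProd_append_cons, h.chainProd_concat hL', List.nil_append]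
  | cons x K ih =>
    have hx := List.pairwise_cons.1 hL
    have ih := ih hx.2 fun y hy => hm y (List.mem_cons_of_mem _ hy)
    have hp : (t :: M ++ s :: R).Pairwise (· > ·) := (List.pairwise_append.1 hx.2).2.1
    have hts : s < t := (List.pairwise_cons.1 hp).1 s (by simp)
    have hxt : t < x := hx.1 t (by simp)
    have hxm : x ≤ m := hm x (by simp)
    have hp' := List.pairwise_append.1 hp
    have hM : ∀ y ∈ t :: M, s < y ∧ y ≤ t := fun y hy =>
      ⟨hp'.2.2 y hy s (by simp), by
        rcases List.mem_cons.1 hy with rfl | hy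
        · exact le_rfl
        · exact ((List.pairwise_cons.1 hp'.1).1 y hy).le⟩
    have hcomm : ∀ y, y < x → ¬ (s < y ∧ y ≤ t) →
        Commute (band σ x y) (chainProd (band σ) (t :: M)) := fun y hyx hy =>
      commute_chainProd hp'.1 fun u hu v hv hvu =>
        (h.commute_of_separated (s := s) (t := t) hvu hyx hxm
          (hM u hu) (hM v hv) (by omega) hy).symm
    cases K with
    | nil =>
      -- Moving `a_{ts}` left past `a_{xt}` turns the latter into `a_{xs}`, which closes the gap in
      -- the outer chain.
      have e := h.band_mul_band' hts hxt hxm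
      have c := (hcomm s (by omega) (by omega)).eq
      simp only [List.nil_append, List.cons_append, chainProd] at ih ⊢
      rw [ih, mul_assoc, ← mul_assoc, ← mul_assoc, e, mul_assoc (band σ t s), c]
      simp only [mul_assoc]
    | cons y K =>
      have hxy : y < x := hx.1 y (by simp)
      have hyt : t < y := (List.pairwise_cons.1 hx.2).1 t (by simp)
      have c := (hcomm y hxy (by omega)).eq
      have c' := (h.commute_band_above hts hyt hxy).eq
      simp only [List.cons_append, chainProd] at ih ⊢
      rw [ih, ← mul_assoc, ← mul_assoc, c', mul_assoc (band σ t s), c]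
      simp only [mul_assoc]

end Band

/-! ### Transpositions, the long cycle and a dimension count. -/

section Perm

lemma band_swap {t s : ℕ} (h : s < t) :
    band (fun i => Equiv.swap i (i + 1)) t s = Equiv.swap s t := by
  induction t, h using Nat.le_induction with
  | base => rw [band_succ_self]
  | succ t ht ih =>
    rw [band_succ _ ht, ih, Equiv.mul_swap_eq_swap_mul, mul_assoc, mul_inv_cancel, mul_one,
      Equiv.swap_apply_left, Equiv.swap_apply_of_ne_of_ne (by omega) (by omega)]

lemma artinSeq_swap (m : ℕ) : ArtinSeq m (fun i : ℕ => Equiv.swap i (i + 1)) where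
  comm i j h := by
    refine Equiv.ext fun k => ?_
    simp only [Equiv.Perm.mul_apply, Equiv.swap_apply_def]
    grind
  braid i h := by
    refine Equiv.ext fun k => ?_
    simp only [Equiv.Perm.mul_apply, Equiv.swap_apply_def]
    grind

/-- The product `(m-1 m) ⋯ (1 2) (0 1)` of transpositions. -/
def cycleProd (m : ℕ) : Equiv.Perm ℕ :=
  ((List.range m).reverse.map fun i => Equiv.swap i (i + 1)).prod

lemma cycleProd_succ (m : ℕ) : cycleProd (m + 1) = Equiv.swap m (m + 1) * cycleProd m := by
  simp [cycleProd, List.range_succ]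

lemma cycleProd_apply (m i : ℕ) :
    cycleProd m i = if i = 0 then m else if i ≤ m then i - 1 else i := by
  induction m with
  | zero => simp [cycleProd]; grind
  | succ m ih =>
    rw [cycleProd_succ, Equiv.Perm.mul_apply, ih, Equiv.swap_apply_def]
    grind

/-- A function invariant under `(s t) c`, where `c` is the cycle `i ↦ i - 1` on `{0, …, m}`,
is constant on `(s, t]` and on the complement. -/
lemma eq_of_invariant_swap_cycleProd {α : Type*} {m s t : ℕ} (hst : s < t) (htm : t ≤ m)
    {g : ℕ → α} (hg : ∀ i, g (Equiv.swap s t (cycleProd m i)) = g i) {i : ℕ} (hi : i ≤ m) :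
    g i = if s < i ∧ i ≤ t then g t else g 0 := by
  have step : ∀ j, j < m → g (j + 1) = if j = s then g t else if j = t then g s else g j := by
    intro j hj
    rw [← hg (j + 1), cycleProd_apply, Equiv.swap_apply_def]
    grind
  induction i with
  | zero => simp
  | succ i ih =>
    have low : ∀ j, j ≤ s → g j = g 0 := by
      intro j
      induction j with
      | zero => simp
      | succ j ihj =>
        intro hj
        rw [step j (by omega), if_neg (by omega), if_neg (by omega), ihj (by omega)]
    have h1 := step i (by omega)
    have h2 := ih (by omega)
    have h3 := low s le_rfl
    grind

lemma exists_ne_zero_of_length_lt {K V : Type*} [Field K] [AddCommGroup V] [Module K V]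
    [FiniteDimensional K V] (l : List (V →ₗ[K] K)) (hl : l.length < Module.finrank K V) :
    ∃ v ≠ 0, ∀ φ ∈ l, φ v = 0 := by
  have h : (LinearMap.pi fun i : Fin l.length => l.get i).ker ≠ ⊥ :=
    LinearMap.ker_ne_bot_of_finrank_lt (by simpa using hl)
  obtain ⟨v, hv, hv0⟩ := Submodule.exists_mem_ne_zero_of_ne_bot h
  refine ⟨v, hv0, fun φ hφ => ?_⟩
  obtain ⟨i, rfl⟩ := List.get_of_mem hφ
  exact congrFun (LinearMap.mem_ker.1 hv) i

end Perm

variable {n : ℕ}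

/-- This separation criterion is the only form in which the six cases are used. -/
lemma obstructingPair_iff (a b : Letter n) : ObstructingPair a b ↔
    ¬ ((a.s < b.t ∧ b.t ≤ a.t) ↔ (a.s < b.s ∧ b.s ≤ a.t)) := by
  constructor
  · intro h
    cases h <;> simp only [Fin.lt_def, Fin.le_def] at * <;> omega
  · obtain ⟨t, s, hst⟩ := a
    obtain ⟨y, x, hxy⟩ := b
    intro h
    simp only at h
    rcases lt_trichotomy x s with h1 | rfl | h1
    · rcases lt_trichotomy y t with h2 | rfl | h2
      · exact .tr_sq t y s x h2 (by grind) h1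
      · exact .ts_tr y s x hst h1
      · grind
    · rcases lt_trichotomy y t with h2 | rfl | h2
      · exact .tr_sr t y x h2 hxy
      · exact .ts_ts y x hst
      · grind
    · rcases lt_trichotomy x t with h2 | rfl | h2
      · exact .sq_tr y t x s (by grind) h2 h1
      · exact .sr_ts y x s hxy h1
      · grind

/-! ### Band generators and `δ` in the braid group. -/

/-- The generators of the braid group, extended by `1` to a sequence. -/
def sigmaSeq (n : ℕ) (i : ℕ) : BraidGroup n := if h : i < n - 1 then sigma ⟨i, h⟩ else 1

lemma sigmaSeq_val (i : Fin (n - 1)) : sigmaSeq n i = sigma i := by simp [sigmaSeq]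

/-- Padding by `1` keeps commutation for all indices, but the braid relation is available only
between genuine generators. -/
lemma artinSeq_sigmaSeq (n : ℕ) : ArtinSeq (n - 1) (sigmaSeq n) where
  comm i j h := by
    by_cases hj : j < n - 1
    · have hi : i < n - 1 := by omega
      simp only [sigmaSeq, hi, hj, dif_pos]
      exact PresentedGroup.mk_eq_mk_of_mul_inv_mem (ArtinRel.comm ⟨i, hi⟩ ⟨j, hj⟩ h)
    · simp [sigmaSeq, hj]
  braid i h := by
    have hi : i < n - 1 := by omega
    simp only [sigmaSeq, hi, h, dif_pos]
    exact PresentedGroup.mk_eq_mk_of_mul_inv_mem (ArtinRel.braid ⟨i, hi⟩ ⟨i + 1, h⟩ rfl)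

lemma map_sigma_filter_finRange (p : ℕ → Prop) [DecidablePred p] :
    ((((List.finRange (n - 1)).filter fun i : Fin (n - 1) => p i).reverse).map sigma) =
      (((List.range (n - 1)).filter fun i => p i).reverse).map (sigmaSeq n) := by
  rw [← List.map_coe_finRange_eq_range, List.filter_map, ← List.map_reverse, List.map_map]
  exact List.map_congr_left fun i _ => (sigmaSeq_val i).symm

lemma filter_range_of_le (s : ℕ) {t m : ℕ} (h : t ≤ m) :
    ((List.range m).filter fun i => s < i ∧ i < t) = (List.range t).filter fun i => s < i := by
  induction m, h using Nat.le_induction with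
  | base => exact List.filter_congr fun i hi => by simp [List.mem_range.1 hi]
  | succ m hm ih => rw [List.range_succ, List.filter_append, ih]; simp; omega

lemma conj_prod_filter_range {G : Type*} [Group G] (σ : ℕ → G) {t s : ℕ} (h : s < t) :
    (((List.range t).filter fun i => s < i).reverse.map σ).prod * σ s *
      (((List.range t).filter fun i => s < i).reverse.map σ).prod⁻¹ = band σ t s := by
  induction t, h using Nat.le_induction with
  | base =>
    have : ((List.range (s + 1)).filter fun i => s < i) = [] := by
      simp only [List.filter_eq_nil_iff, List.mem_range, decide_eq_true_eq]; omega
    simp [this, band_succ_self]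
  | succ t ht ih =>
    have hf : ([t].filter fun i => decide (s < i)) = [t] := by
      simpa using ht
    rw [band_succ σ ht, ← ih, List.range_succ, List.filter_append, hf, List.reverse_append,
      List.map_append, List.prod_append]
    simp [mul_assoc]

lemma Letter.toBraid_eq_band (a : Letter n) : a.toBraid = band (sigmaSeq n) a.t a.s := by
  have hst : (a.s : ℕ) < a.t := a.s_lt_t
  have ht := a.t.isLt
  have hc : a.conjugator =
      (((List.range a.t).filter fun i => (a.s : ℕ) < i).reverse.map (sigmaSeq n)).prod := by
    rw [Letter.conjugator, map_sigma_filter_finRange (fun i => (a.s : ℕ) < i ∧ i < a.t),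
      filter_range_of_le _ (by omega)]
  rw [Letter.toBraid, hc, ← conj_prod_filter_range _ hst, ← sigmaSeq_val a.low]
  rfl

lemma delta_eq_prod : delta n = ((List.range (n - 1)).reverse.map (sigmaSeq n)).prod := by
  rw [delta, PositiveWord.toBraid, deltaWord, List.map_map, ← List.map_coe_finRange_eq_range,
    ← List.map_reverse, List.map_map]
  congr 1
  refine List.map_congr_left fun i _ => ?_
  simp only [Function.comp_apply, Letter.toBraid_eq_band, adjacentLetter, band_succ_self]

lemma prod_range_reverse_eq_chainProd {G : Type*} [Group G] (σ : ℕ → G) (m : ℕ) :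
    ((List.range m).reverse.map σ).prod = chainProd (band σ) (List.range (m + 1)).reverse := by
  induction m with
  | zero => simp [chainProd]
  | succ m ih =>
    rw [List.range_succ, List.range_succ (n := m + 1), List.reverse_append, List.map_append,
      List.prod_append, ih, List.range_succ]
    simp [chainProd, band_succ_self]

lemma delta_eq_chainProd : delta n = chainProd (band (sigmaSeq n)) (List.range n).reverse := by
  rw [delta_eq_prod, prod_range_reverse_eq_chainProd]
  rcases n with _ | n
  · simp [chainProd]
  · simp

lemma PositiveWord.toBraid_append (A B : PositiveWord n) :
    PositiveWord.toBraid (A ++ B) = A.toBraid * B.toBraid := by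
  simp [PositiveWord.toBraid]

lemma PositiveWord.toBraid_cons (a : Letter n) (B : PositiveWord n) :
    PositiveWord.toBraid (a :: B) = a.toBraid * B.toBraid := by
  simp [PositiveWord.toBraid]

lemma PositiveWord.toBraid_mem (A : PositiveWord n) : A.toBraid ∈ positiveBraids n := by
  refine Submonoid.list_prod_mem _ fun x hx => ?_
  obtain ⟨a, -, rfl⟩ := List.mem_map.1 hx
  exact Submonoid.subset_closure ⟨a, rfl⟩

lemma exists_positiveWord {W : BraidGroup n} (h : W ∈ positiveBraids n) :
    ∃ A : PositiveWord n, A.toBraid = W := by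
  induction h using Submonoid.closure_induction with
  | mem x hx => obtain ⟨a, rfl⟩ := hx; exact ⟨[a], by simp [PositiveWord.toBraid]⟩
  | one => exact ⟨[], rfl⟩
  | mul x y _ _ hx hy =>
    obtain ⟨A, rfl⟩ := hx
    obtain ⟨B, rfl⟩ := hy
    exact ⟨A ++ B, A.toBraid_append B⟩

/-! ### Exponent sum and strand permutation. -/

/-- The exponent sum of a braid. -/
def braidLength (n : ℕ) : BraidGroup n →* Multiplicative ℤ :=
  PresentedGroup.toGroup (f := fun _ => Multiplicative.ofAdd 1) (by
    rintro _ (⟨i, j, h⟩ | ⟨i, j, h⟩) <;> simp)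

lemma braidLength_toBraid (A : PositiveWord n) :
    braidLength n A.toBraid = Multiplicative.ofAdd (A.length : ℤ) := by
  induction A with
  | nil => simp [PositiveWord.toBraid]
  | cons a A ih =>
    rw [PositiveWord.toBraid_cons, map_mul, ih, Letter.toBraid, map_mul, map_mul, map_inv,
      mul_inv_cancel_comm, sigma, braidLength, PresentedGroup.toGroup.of,
      ← ofAdd_add, List.length_cons]
    push_cast
    rw [add_comm]

/-- The permutation of the strands, extended by the identity to `ℕ`. -/
def braidPerm (n : ℕ) : BraidGroup n →* Equiv.Perm ℕ :=
  PresentedGroup.toGroup (f := fun i : Fin (n - 1) => Equiv.swap (i : ℕ) (i + 1)) (by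
    rintro _ (⟨i, j, h⟩ | ⟨i, j, h⟩)
    · simp only [map_mul, map_inv, FreeGroup.lift_apply_of, mul_inv_eq_one]
      exact (artinSeq_swap n).comm i j h
    · simp only [map_mul, map_inv, FreeGroup.lift_apply_of, mul_inv_eq_one, ← h]
      exact (artinSeq_swap n).braid i (by omega))

lemma braidPerm_sigmaSeq {i : ℕ} (h : i < n - 1) :
    braidPerm n (sigmaSeq n i) = Equiv.swap i (i + 1) := by
  simp only [sigmaSeq, h, dif_pos, sigma, braidPerm, PresentedGroup.toGroup.of]

lemma band_congr {G : Type*} [Group G] {σ τ : ℕ → G} {t s : ℕ} (hst : s < t)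
    (h : ∀ i < t, σ i = τ i) : band σ t s = band τ t s := by
  induction t, hst using Nat.le_induction with
  | base => rw [band_succ_self, band_succ_self, h s (by omega)]
  | succ t ht ih =>
    rw [band_succ _ ht, band_succ _ ht, ih fun i hi => h i (by omega), h t (by omega)]

lemma braidPerm_letter (a : Letter n) :
    braidPerm n a.toBraid = Equiv.swap (a.s : ℕ) (a.t : ℕ) := by
  rw [a.toBraid_eq_band, map_band, ← band_swap a.s_lt_t]
  have := a.t.isLt
  exact band_congr a.s_lt_t fun i hi => braidPerm_sigmaSeq (by omega)

lemma braidPerm_delta : braidPerm n (delta n) = cycleProd (n - 1) := by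
  rw [delta_eq_prod, map_list_prod, List.map_map, cycleProd]
  congr 1
  exact List.map_congr_left fun i hi => braidPerm_sigmaSeq (by simpa using hi)

lemma apply_braidPerm_eq {α : Type*} {g : ℕ → α} {A : PositiveWord n}
    (h : ∀ a ∈ A, g a.t = g a.s) (i : ℕ) : g (braidPerm n A.toBraid i) = g i := by
  induction A with
  | nil => simp [PositiveWord.toBraid]
  | cons a A ih =>
    rw [PositiveWord.toBraid_cons, map_mul, Equiv.Perm.mul_apply,
      ← ih fun b hb => h b (List.mem_cons_of_mem _ hb), braidPerm_letter, Equiv.swap_apply_def]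
    have := h a (by simp)
    grind

/-! ### Necessity: words for `δ`. -/

/-- In a positive word for `δ`, no earlier letter obstructs a later one. -/
lemma not_obstructingPair_of_toBraid_eq_delta {B C : PositiveWord n} {a b : Letter n}
    (h : PositiveWord.toBraid (B ++ a :: C) = delta n) (hb : b ∈ C) : ¬ ObstructingPair a b := by
  have hlen : B.length + C.length + 1 = n - 1 := by
    have h1 := congrArg (braidLength n) h
    rw [delta, braidLength_toBraid, braidLength_toBraid] at h1
    have h2 := Multiplicative.ofAdd.injective h1
    simp [deltaWord] at h2
    omega
  set c := cycleProd (n - 1) with hc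
  have hperm : braidPerm n B.toBraid * Equiv.swap (a.s : ℕ) a.t * braidPerm n C.toBraid = c := by
    rw [hc, ← braidPerm_delta, ← h, PositiveWord.toBraid_append, PositiveWord.toBraid_cons,
      map_mul, map_mul, braidPerm_letter, mul_assoc]
  let ext : (Fin n → ℚ) →ₗ[ℚ] (ℕ → ℚ) :=
    LinearMap.pi fun i => if h : i < n then LinearMap.proj ⟨i, h⟩ else 0
  let ev : ℕ → (Fin n → ℚ) →ₗ[ℚ] ℚ := fun i => LinearMap.proj i ∘ₗ ext
  -- These are `1 + |C| + |B| = n - 1` conditions in dimension `n`. The twist by `c⁻¹` is there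
  -- because `B` enters `hfac` conjugated by `c`.
  let l : List ((Fin n → ℚ) →ₗ[ℚ] ℚ) := ev 0 :: (C.map fun x => ev x.t - ev x.s) ++
    (B.map fun x => ev (c⁻¹ x.t) - ev (c⁻¹ x.s))
  obtain ⟨f, hf0, hf⟩ := exists_ne_zero_of_length_lt l (by simp [l]; omega)
  set g := ext f with hgdef
  have hg0 : g 0 = 0 := hf (ev 0) (by simp [l])
  have hgC : ∀ x ∈ C, g x.t = g x.s := fun x hx => sub_eq_zero.1 <|
    hf (ev x.t - ev x.s) (by simp only [l, List.mem_append, List.mem_cons, List.mem_map]; grind)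
  have hgB : ∀ x ∈ B, (g ∘ ⇑c⁻¹) x.t = (g ∘ ⇑c⁻¹) x.s := fun x hx => sub_eq_zero.1 <|
    hf (ev (c⁻¹ x.t) - ev (c⁻¹ x.s))
      (by simp only [l, List.mem_append, List.mem_cons, List.mem_map]; grind)
  have hfac : Equiv.swap (a.s : ℕ) a.t * c =
      braidPerm n C.toBraid * (c⁻¹ * braidPerm n B.toBraid * c) := by
    have hC : braidPerm n C.toBraid =
        Equiv.swap (a.s : ℕ) a.t * (braidPerm n B.toBraid)⁻¹ * c := by
      rw [← hperm, mul_assoc, mul_assoc, inv_mul_cancel_left, Equiv.swap_mul_self_mul]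
    rw [hC]
    group
  have hinv : ∀ i, g (Equiv.swap (a.s : ℕ) a.t (c i)) = g i := fun i => by
    rw [← Equiv.Perm.mul_apply, hfac, Equiv.Perm.mul_apply, apply_braidPerm_eq hgC]
    have := apply_braidPerm_eq hgB (c i)
    simpa using this
  have ht := a.t.isLt
  have key := fun i => eq_of_invariant_swap_cycleProd (i := i) a.s_lt_t
    (show (a.t : ℕ) ≤ n - 1 by omega) hinv
  -- `g` takes only the values `g a.t` on `(s, t]` and `g 0 = 0` elsewhere.
  have hgt : g a.t ≠ 0 := fun hgt => hf0 <| funext fun i => by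
    have := key i (by omega)
    rw [hg0, hgt, ite_self] at this
    simpa [hgdef, ext] using this
  have hbt := key b.t (by omega)
  have hbs := key b.s (by omega)
  have hbC := hgC b hb
  rw [obstructingPair_iff, not_not]
  simp only [Fin.lt_def, Fin.le_def]
  rw [hg0] at hbt hbs
  grind

/-! ### Sufficiency: dividing chain products. -/

lemma toBraid_eq_filter_mul_filter (p : Letter n → Bool) (A : PositiveWord n)
    (h : ∀ a ∈ A, ∀ b ∈ A, p a → ¬ p b → Commute a.toBraid b.toBraid) :
    A.toBraid = PositiveWord.toBraid (A.filter (! p ·)) * PositiveWord.toBraid (A.filter p) := by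
  induction A with
  | nil => simp [PositiveWord.toBraid]
  | cons b A ih =>
    have ih := ih fun x hx y hy => h x (List.mem_cons_of_mem _ hx) y (List.mem_cons_of_mem _ hy)
    rw [PositiveWord.toBraid_cons, ih]
    by_cases hb : p b
    · have hc : Commute b.toBraid (PositiveWord.toBraid (A.filter (! p ·))) := by
        refine Commute.list_prod_right _ _ fun x hx => ?_
        obtain ⟨a, ha, rfl⟩ := List.mem_map.1 hx
        have ha := List.mem_filter.1 ha
        exact h b (by simp) a (List.mem_cons_of_mem _ ha.1) hb (by simpa using ha.2)
      simp only [List.filter_cons, hb, PositiveWord.toBraid_cons, Bool.not_true, if_true,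
        Bool.false_eq_true, if_false]
      rw [← mul_assoc, hc.eq, mul_assoc]
    · simp [hb, PositiveWord.toBraid_cons, mul_assoc]

lemma exists_split_of_mem {L : List ℕ} (hL : L.Pairwise (· > ·)) {t s : ℕ} (ht : t ∈ L)
    (hs : s ∈ L) (hst : s < t) : ∃ K M R, L = K ++ (t :: M ++ s :: R) := by
  obtain ⟨K, N, rfl⟩ := List.append_of_mem ht
  have hsN : s ∈ N := by
    rcases List.mem_append.1 hs with h | h
    · have := (List.pairwise_append.1 hL).2.2 s h t (by simp)
      omega
    · rcases List.mem_cons.1 h with rfl | h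
      · omega
      · exact h
  obtain ⟨M, R, rfl⟩ := List.append_of_mem hsN
  exact ⟨K, M, R, by simp⟩

/-- A word without obstructing pairs whose indices lie in a decreasing list left-divides the
product along the list. -/
lemma exists_mul_eq_chainProd (A : PositiveWord n) (L : List ℕ) (hL : L.Pairwise (· > ·))
    (hn : ∀ x ∈ L, x < n) (hA : ∀ a ∈ A, (a.t : ℕ) ∈ L ∧ (a.s : ℕ) ∈ L)
    (hobs : A.Pairwise fun a b => ¬ ObstructingPair a b) :
    ∃ P ∈ positiveBraids n, A.toBraid * P = chainProd (band (sigmaSeq n)) L := by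
  match A with
  | [] =>
    refine ⟨_, ?_, one_mul _⟩
    clear hobs hA
    induction L with
    | nil => exact one_mem _
    | cons x L ih =>
      cases L with
      | nil => exact one_mem _
      | cons y L =>
        have hx := List.pairwise_cons.1 hL
        refine mul_mem ?_ (ih hx.2 fun z hz => hn z (List.mem_cons_of_mem _ hz))
        refine Submonoid.subset_closure
          ⟨⟨⟨x, hn x (by simp)⟩, ⟨y, hn y (by simp)⟩, hx.1 y (by simp)⟩, ?_⟩
        rw [Letter.toBraid_eq_band]
  | a :: A =>
    have hst : (a.s : ℕ) < a.t := a.s_lt_t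
    obtain ⟨K, M, R, rfl⟩ := exists_split_of_mem hL (hA a (by simp)).1 (hA a (by simp)).2 hst
    obtain ⟨hobs₁, hobs₂⟩ := List.pairwise_cons.1 hobs
    have hA' := fun b hb => hA b (List.mem_cons_of_mem a hb)
    have hσ := artinSeq_sigmaSeq n
    have hp := List.pairwise_append.1 hL
    have hp' := List.pairwise_append.1 hp.2.1
    have hK : ∀ x ∈ K, (a.t : ℕ) < x := fun x hx => hp.2.2 x hx _ (by simp)
    have hM : ∀ x ∈ M, (a.s : ℕ) < x ∧ x < a.t := fun x hx =>
      ⟨hp'.2.2 x (by simp [hx]) _ (by simp), (List.pairwise_cons.1 hp'.1).1 x hx⟩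
    have hR : ∀ x ∈ R, x < (a.s : ℕ) := (List.pairwise_cons.1 hp'.2.1).1
    -- Testing the upper index alone suffices: as `a` obstructs no later letter, the lower index
    -- lies on the same side.
    let p : Letter n → Bool := fun b => decide ((a.s : ℕ) < b.t ∧ (b.t : ℕ) ≤ a.t)
    have hblock : ∀ b ∈ A, (p b = true ↔ ((a.s : ℕ) < b.s ∧ (b.s : ℕ) ≤ a.t)) := fun b hb => by
      have := hobs₁ b hb
      rw [obstructingPair_iff, not_not] at this
      exact decide_eq_true_iff.trans this
    obtain ⟨P, hP, hPeq⟩ := exists_mul_eq_chainProd (A.filter p) (a.t :: M) hp'.1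
      (fun x hx => hn x (by
        rw [List.mem_append, List.mem_append]; exact .inr (.inl hx)))
      (fun b hb => by
        obtain ⟨hb, hpb⟩ := List.mem_filter.1 hb
        have h1 := (hblock b hb).1 hpb
        have h2 := hA' b hb
        have h3 : (a.s : ℕ) < b.t ∧ (b.t : ℕ) ≤ a.t := by simpa [p] using hpb
        simp only [List.mem_append, List.mem_cons] at h2 ⊢
        grind)
      (hobs₂.filter p)
    obtain ⟨Q, hQ, hQeq⟩ := exists_mul_eq_chainProd (A.filter (! p ·)) (K ++ (a.s : ℕ) :: R)
      (hL.sublist (by simp))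
      (fun x hx => hn x (by
        rw [List.mem_append] at hx ⊢; rw [List.mem_append]; tauto))
      (fun b hb => by
        obtain ⟨hb, hpb⟩ := List.mem_filter.1 hb
        have hpb : ¬ p b = true := by simpa using hpb
        have h1 := (hblock b hb).not.1 hpb
        have h2 := hA' b hb
        have h3 : ¬ ((a.s : ℕ) < b.t ∧ (b.t : ℕ) ≤ a.t) := by simpa [p] using hpb
        simp only [List.mem_append, List.mem_cons] at h2 ⊢
        grind)
      (hobs₂.filter _)
    have hsep : ∀ b ∈ A, ∀ x y : ℕ, p b → y < x → x < n →
        ¬ ((a.s : ℕ) < x ∧ x ≤ a.t) → ¬ ((a.s : ℕ) < y ∧ y ≤ a.t) →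
        Commute b.toBraid (band (sigmaSeq n) x y) := fun b hb x y hpb hyx hxn hx hy => by
      rw [b.toBraid_eq_band]
      exact hσ.commute_of_separated b.s_lt_t hyx (by omega) (by simpa [p] using hpb)
        ((hblock b hb).1 hpb) hx hy
    have hfac := toBraid_eq_filter_mul_filter p A fun b hb d hd hpb hpd => by
      rw [d.toBraid_eq_band]
      exact hsep b hb _ _ hpb d.s_lt_t d.t.isLt (by simpa [p] using hpd)
        ((hblock d hd).not.1 hpd)
    -- The outer letters must pass the whole inner chain, including its complement `P`, before
    -- meeting `Q`.
    have hcomm : Commute (PositiveWord.toBraid (A.filter (! p ·)))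
        (chainProd (band (sigmaSeq n)) (a.t :: M)) := by
      refine commute_chainProd hp'.1 fun x hx y hy hyx => ?_
      refine (Commute.list_prod_right _ _ fun z hz => ?_).symm
      obtain ⟨d, hd, rfl⟩ := List.mem_map.1 hz
      obtain ⟨hd, hpd⟩ := List.mem_filter.1 hd
      have hpd : ¬ p d = true := by simpa using hpd
      have hxM : (a.s : ℕ) < x ∧ x ≤ a.t := by grind
      have hyM : (a.s : ℕ) < y ∧ y ≤ a.t := by grind
      rw [d.toBraid_eq_band]
      exact hσ.commute_of_separated hyx d.s_lt_t (by omega) hxM hyM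
        (by simpa [p] using hpd) ((hblock d hd).not.1 hpd)
    refine ⟨P * Q, mul_mem hP hQ, ?_⟩
    rw [hσ.chainProd_split hL fun x hx => by have := hn x hx; omega,
      PositiveWord.toBraid_cons, a.toBraid_eq_band, hfac, ← hPeq, ← hQeq]
    have hcomm := hcomm.eq
    rw [← hPeq] at hcomm
    generalize PositiveWord.toBraid (A.filter p) = x at *
    generalize PositiveWord.toBraid (A.filter (! p ·)) = y at *
    calc band (sigmaSeq n) a.t a.s * (y * x) * (P * Q)
        = band (sigmaSeq n) a.t a.s * (y * (x * P)) * Q := by simp only [mul_assoc]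
      _ = _ := by rw [hcomm]; simp only [mul_assoc]
termination_by A.length
decreasing_by
  all_goals
    simp only [List.length_cons, Nat.lt_succ_iff]
    exact List.length_filter_le _ _

lemma containsObstructingPair_iff (A : PositiveWord n) :
    A.ContainsObstructingPair ↔ ¬ A.Pairwise fun a b => ¬ ObstructingPair a b := by
  constructor
  · rintro ⟨B, C, D, a, b, rfl, h⟩ hp
    simp only [List.append_assoc] at hp
    have h1 := (List.pairwise_append.1 (List.pairwise_append.1 hp).2.1).2.2 a (by simp) b (by simp)
    exact h1 h
  · intro h
    induction A with
    | nil => simp at h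
    | cons a A ih =>
      rw [List.pairwise_cons, not_and_or] at h
      rcases h with h | h
      · push Not at h
        obtain ⟨b, hb, hab⟩ := h
        obtain ⟨C, D, rfl⟩ := List.append_of_mem hb
        exact ⟨[], C, D, a, b, by simp, hab⟩
      · obtain ⟨B, C, D, x, y, rfl, hxy⟩ := ih h
        exact ⟨a :: B, C, D, x, y, by simp, hxy⟩

end BandBraid

theorem mainTheorem9 (n : ℕ) (A : BandBraid.PositiveWord n) :
    BandBraid.IsCanonicalFactor (BandBraid.PositiveWord.toBraid A) ↔
      ¬ BandBraid.PositiveWord.ContainsObstructingPair A := by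
  open BandBraid in
  constructor
  · rintro ⟨-, P₁, hP₁, P₂, hP₂, hδ⟩ ⟨B, C, D, a, b, rfl, hab⟩
    obtain ⟨B', rfl⟩ := exists_positiveWord hP₁
    obtain ⟨D', rfl⟩ := exists_positiveWord hP₂
    refine not_obstructingPair_of_toBraid_eq_delta (B := B' ++ B) (C := C ++ b :: D ++ D')
      (a := a) ?_ (by simp) hab
    rw [hδ, ← PositiveWord.toBraid_append, ← PositiveWord.toBraid_append]
    simp
  · rw [containsObstructingPair_iff, not_not]
    intro h
    refine ⟨⟨_, one_mem _, _, A.toBraid_mem, by simp⟩, 1, one_mem _, ?_⟩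
    obtain ⟨P, hP, hPA⟩ := exists_mul_eq_chainProd A (List.range n).reverse
      (List.pairwise_reverse.2 List.pairwise_lt_range) (by simp) (by simp) h
    exact ⟨P, hP, by rw [delta_eq_chainProd, ← hPA, one_mul]⟩
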